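/- Power beacons (PBs), each with $M\ge 1$ antennas and transmit power $P_p>0$, are located at the points of a homogeneous Poisson point process $\Phi_p$ of density $\lambda_p>0$ in $\mathbb R^2$. A secondary user (SU) sits at a fixed point of the plane (without loss of generality the origin); $d_p$ is the distance from the PB $p$ to the SU, and $\mathbf h_p\in\mathbb C^{M}$ is the channel vector from $p$ to the SU. All entries of all the $\mathbf h_p$ are i.i.d. circularly symmetric complex Gaussian $\mathcal{CN}(0,1)$, independent of $\Phi_p$, and constant during a frame of length $T>0$. The path loss is $L(d)=Ad^{-\xi}$ with $A>0$, $\xi\ge 2$, the radius of the protection zone is $d_0>0$, and the energy harvested by the SU during a fraction $\gamma$ of the frame is $$E(\gamma)=\max_{p\in\Phi_p,\ d_p\ge d_0}\big\{\|\mathbf h_p\|^2L(d_p)\big\}\,\eta P_p\gamma T ,\qquad \eta>0 .$$ Let $\alpha_1,\beta,\alpha_2\ge 0$ be the fractions of the frame for first energy harvesting, spectrum sensing and second energy harvesting, with $\alpha_1+\alpha_2>0$ and $\alpha_1+\beta+\alpha_2<1$, the remaining fraction being used for data transmission. Let $P_s\ge 0$ be the sensing power and $P_t>0$ the threshold power for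 data transmission. For an active SU (which harvests in the first and third slots and senses in the second) and an inactive SU (which harvests in all slots before data transmission), the powers available for data transmission are, respectively, $$P_{T_2}=\frac{\big(E(\alpha_1)-P_s\beta T\big)+E(\alpha_2)}{(1-\alpha_1-\beta-\alpha_2)T},\qquad P_{H_3}=\frac{E(\alpha_1+\beta+\alpha_2)}{(1-\alpha_1-\beta-\alpha_2)T},$$ and the power outage probabilities of data transmission are the (unconditional) probabilities $P_a^{out}=\Pr\{P_{T_2}\le P_t\}$ and $P_i^{out}=\Pr\{P_{H_3}<P_t\}$. Theorem. Almost surely the maximum above is attained, and for $\psi\in\{a,i\}$ $$P_\psi^{out}=\exp\left[-\frac{\pi\lambda_p\delta}{\mu_\psi^{\delta}}\sum_{m=0}^{M-1}\frac{\Gamma(m+\delta,\mu_\psi d_0^{\xi})}{m!}\right],$$ where $\delta=2/\xi$, $\Gamma(s,x)=\int_x^\infty t^{s-1}e^{-t}\,dt$ is the upper incomplete Gamma function, and $$\mu_a=\frac{P_t(1-\alpha_1-\beta-\alpha_2)+P_s\beta}{\eta P_pA(\alpha_1+\alpha_2)},\qquad \mu_i=\frac{P_t(1-\alpha_1-\beta-\alpha_2)}{\eta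 P_pA(\alpha_1+\beta+\alpha_2)} .$$ -/

import Mathlib

open MeasureTheory ProbabilityTheory

namespace WPCR

noncomputable section

/-- The plane `ℝ²` with its Euclidean distance; `volume` is Lebesgue measure. -/
abbrev Plane : Type := EuclideanSpace ℝ (Fin 2)

/-- Number of points of the family `X` lying in the set `B`. -/
def pointCount {Ω E : Type*} (X : ℕ → Ω → E) (B : Set E) (ω : Ω) : ℕ∞ :=
  {n : ℕ | X n ω ∈ B}.encard

/-- The points `X 0, X 1, …` form a Poisson point process with intensity measure `ν` (of infinite
total mass, so that there are almost surely infinitely many points, enumerated here by `ℕ`): the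
number of points in a measurable set `B` with `ν B < ∞` is Poisson distributed with mean `ν B`,
and the numbers of points in finitely many pairwise disjoint measurable sets are independent. -/
structure IsPoissonPointProcess {Ω E : Type*} [MeasurableSpace Ω] [MeasurableSpace E]
    (X : ℕ → Ω → E) (ν : Measure E) (P : Measure Ω) : Prop where
  measurable : ∀ n, Measurable (X n)
  poisson : ∀ B : Set E, MeasurableSet B → ν B ≠ ⊤ →
    HasLaw (pointCount X B) ((poissonMeasure (ν B).toNNReal).map (Nat.cast : ℕ → ℕ∞)) P
  indep : ∀ (k : ℕ) (B : Fin k → Set E), (∀ i, MeasurableSet (B i)) →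
    Pairwise (fun i j => Disjoint (B i) (B j)) →
    iIndepFun (fun i => pointCount X (B i)) P

/-- The standard complex Gaussian law `CN(0,1)` (zero mean, unit variance): real and imaginary
parts are independent real Gaussians with mean `0` and variance `1/2`. -/
def stdComplexGaussian : Measure ℂ :=
  ((gaussianReal 0 (1 / 2)).prod (gaussianReal 0 (1 / 2))).map
    (fun z : ℝ × ℝ => (⟨z.1, z.2⟩ : ℂ))

/-- The random environment of one frame: the power beacons sit at the points `X n` of a homogeneous
Poisson point process of density `lam` in the plane, `h n` is the channel vector from the `M`
antennas of the `n`-th beacon to the secondary user, all channel coefficients are i.i.d. `CN(0,1)`,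
and they are independent of the beacon positions. -/
structure IsBeaconField {Ω : Type*} [MeasurableSpace Ω] {M : ℕ} (lam : ℝ)
    (X : ℕ → Ω → Plane) (h : ℕ → Ω → EuclideanSpace ℂ (Fin M)) (P : Measure Ω) : Prop where
  ppp : IsPoissonPointProcess X (ENNReal.ofReal lam • (volume : Measure Plane)) P
  measurable_channel : ∀ n, Measurable (h n)
  law_channel : ∀ n m, HasLaw (fun ω => h n ω m) stdComplexGaussian P
  indep_channel : iIndepFun (fun (q : ℕ × Fin M) (ω : Ω) => h q.1 ω q.2) P
  indep_position_channel : IndepFun (fun ω n => X n ω) (fun ω n => h n ω) P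

/-- The deterministic parameters of the network. -/
structure Params where
  /-- number of antennas of each power beacon -/
  M : ℕ
  /-- density of the power beacons -/
  lam : ℝ
  /-- radius of the protection zone -/
  d₀ : ℝ
  /-- path-loss exponent -/
  ξ : ℝ
  /-- frequency dependent path-loss constant -/
  A : ℝ
  /-- power conversion efficiency -/
  η : ℝ
  /-- transmit power of the beacons -/
  Pp : ℝ
  /-- sensing power -/
  Ps : ℝ
  /-- threshold (transmit) power for data transmission -/
  Pt : ℝ
  /-- frame length -/
  T : ℝ
  /-- fraction of the frame for the first harvesting slot -/
  α₁ : ℝ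
  /-- fraction of the frame for the sensing slot -/
  β : ℝ
  /-- fraction of the frame for the second harvesting slot -/
  α₂ : ℝ

namespace Params

/-- The standing assumptions on the parameters. -/
structure Admissible (p : Params) : Prop where
  M_pos : 0 < p.M
  lam_pos : 0 < p.lam
  d₀_pos : 0 < p.d₀
  two_le_ξ : 2 ≤ p.ξ
  A_pos : 0 < p.A
  η_pos : 0 < p.η
  Pp_pos : 0 < p.Pp
  Ps_nonneg : 0 ≤ p.Ps
  Pt_pos : 0 < p.Pt
  T_pos : 0 < p.T
  α₁_nonneg : 0 ≤ p.α₁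
  β_nonneg : 0 ≤ p.β
  α₂_nonneg : 0 ≤ p.α₂
  harvest_pos : 0 < p.α₁ + p.α₂
  transmit_pos : p.α₁ + p.β + p.α₂ < 1

variable {Ω : Type*} (p : Params) (X : ℕ → Ω → Plane) (h : ℕ → Ω → EuclideanSpace ℂ (Fin p.M))
  (y : Plane)

/-- Path loss `L(d) = A d ^ (-ξ)`. -/
def pathLoss (d : ℝ) : ℝ := p.A * d ^ (-p.ξ)

/-- The channel gains `‖h‖² L(d)` from the beacons outside the protection zone to a user at `y`. -/
def gains (ω : Ω) : Set ℝ :=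
  {g | ∃ n : ℕ, p.d₀ ≤ dist (X n ω) y ∧ g = ‖h n ω‖ ^ 2 * p.pathLoss (dist (X n ω) y)}

/-- The strongest channel gain. -/
def maxGain (ω : Ω) : ℝ := sSup (p.gains X h y ω)

/-- Energy harvested from the strongest beacon during a fraction `γ` of the frame. -/
def harvestedEnergy (γ : ℝ) (ω : Ω) : ℝ := p.maxGain X h y ω * p.η * p.Pp * γ * p.T

/-- Energy consumed by spectrum sensing. -/
def sensingEnergy : ℝ := p.Ps * p.β * p.T

/-- Power available for data transmission at an active user: what remains of the energy of the
first slot after sensing, plus the energy harvested in the third slot, spent over the fourth. -/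
def activePower (ω : Ω) : ℝ :=
  ((p.harvestedEnergy X h y p.α₁ ω - p.sensingEnergy) + p.harvestedEnergy X h y p.α₂ ω) /
    ((1 - p.α₁ - p.β - p.α₂) * p.T)

/-- Power available for data transmission at an inactive user, which harvests during all the slots
before data transmission. -/
def inactivePower (ω : Ω) : ℝ :=
  p.harvestedEnergy X h y (p.α₁ + p.β + p.α₂) ω / ((1 - p.α₁ - p.β - p.α₂) * p.T)

/-- The threshold `μ_a`. -/
def muActive : ℝ :=
  (p.Pt * (1 - p.α₁ - p.β - p.α₂) + p.Ps * p.β) / (p.η * p.Pp * p.A * (p.α₁ + p.α₂))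

/-- The threshold `μ_i`. -/
def muInactive : ℝ :=
  p.Pt * (1 - p.α₁ - p.β - p.α₂) / (p.η * p.Pp * p.A * (p.α₁ + p.β + p.α₂))

/-- `δ = 2 / ξ`. -/
def δ : ℝ := 2 / p.ξ

end Params

/-- The upper incomplete Gamma function `Γ(s, x)`. -/
def upperGamma (s x : ℝ) : ℝ := ∫ t in Set.Ioi x, t ^ (s - 1) * Real.exp (-t)

/-- The closed form `exp[-(π λ δ / μ^δ) ∑_{m<M} Γ(m + δ, μ d₀^ξ) / m!]`. -/
def Params.outageFormula (p : Params) (μ : ℝ) : ℝ :=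
  Real.exp (-(Real.pi * p.lam * p.δ / μ ^ p.δ *
    ∑ m ∈ Finset.range p.M, upperGamma (m + p.δ) (μ * p.d₀ ^ p.ξ) / (m.factorial : ℝ)))

end

end WPCR

/-! The harvested energy is linear in γ with the same random maximum in every slot, so both outage
events say that the strongest gain stays below a deterministic level Aμ (`activePower_le_iff`,
`inactivePower_lt_iff`). Equivalently, no beacon outside the protection zone has a pair (position,
‖h‖²) in a certain region of plane × line.

The marks ‖h‖² are i.i.d. Erlang of shape M and independent of the positions
(`IsBeaconField.isIndepMarking`). Conditioning on the positions and using the generating functional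
E ∏(1 - g(X n)) = exp(-∫ g dν) (`IsPoissonPointProcess.lintegral_iInf_prod`), the probability of an
empty region is exp(-mean number of points in it) (`measure_forall_notMem`). That mean is λ times
the integral of Pr(Erlang > μ r^ξ) over r ≥ d₀; polar coordinates and t = μ r^ξ turn it into the
incomplete Gamma sum (`lintegral_erlangTail_dist`).

The maximum is attained almost surely: above any positive level the mean number of gains is finite,
so there are finitely many, while above 0 it is infinite, so some gain is positive. Since the Erlang
law has no atom at positive points, the events with ≤ and < share one formula. -/

namespace WPCR

open Filter Topology Finset
open scoped ENNReal NNReal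

/-! ### Generating functional of a Poisson point process -/

section PoissonProcess

/-- The probability generating function of the Poisson law. -/
lemma lintegral_pow_poissonMeasure (r : ℝ≥0) {c : ℝ≥0∞} (hc : c ≤ 1) :
    ∫⁻ n, (1 - c) ^ n ∂(poissonMeasure r) = EReal.exp (-((c * r : ℝ≥0∞) : EReal)) := by
  lift c to ℝ≥0 using ne_top_of_le_ne_top ENNReal.one_ne_top hc
  have hc' : c ≤ 1 := by exact_mod_cast hc
  have hrhs : EReal.exp (-(((c : ℝ≥0∞) * r : ℝ≥0∞) : EReal)) =
      ENNReal.ofReal (Real.exp (-(c * r))) := by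
    rw [← EReal.exp_coe]
    rw [← ENNReal.coe_mul, EReal.coe_nnreal_eq_coe_real, NNReal.coe_mul, EReal.coe_neg]
  rw [hrhs, lintegral_countable']
  have hterm : ∀ n : ℕ, (1 - (c : ℝ≥0∞)) ^ n * poissonMeasure r {n} =
      ENNReal.ofReal (Real.exp (-r) * (((1 - c) * r) ^ n / n.factorial)) := by
    intro n
    have h0 : (0 : ℝ) ≤ 1 - c := by simpa using hc'
    have h1 : (1 - (c : ℝ≥0∞)) = ENNReal.ofReal (1 - c) := by
      rw [ENNReal.ofReal_sub _ c.coe_nonneg]; simp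
    rw [poissonMeasure_singleton, h1, ← ENNReal.ofReal_pow h0, ← ENNReal.ofReal_mul (by positivity)]
    congr 1
    rw [mul_pow]; ring
  simp_rw [hterm]
  have hs : HasSum (fun n : ℕ => Real.exp (-r) * (((1 - c) * r : ℝ) ^ n / n.factorial))
      (Real.exp (-r) * Real.exp ((1 - c) * r)) := by
    refine HasSum.mul_left _ ?_
    rw [Real.exp_eq_exp_ℝ]
    exact NormedSpace.expSeries_div_hasSum_exp _
  have h0 : (0 : ℝ) ≤ 1 - c := by simpa using hc'
  rw [← ENNReal.ofReal_tsum_of_nonneg (fun n => by positivity) hs.summable, hs.tsum_eq,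
    ← Real.exp_add]
  congr 2
  ring

/-- Expectations of products of functions of finitely many independent variables factor. -/
lemma lintegral_prod_comp_of_iIndepFun {Ω ι κ : Type*} [Fintype ι] [MeasurableSpace Ω]
    [MeasurableSpace κ] {P : Measure Ω} {N : ι → Ω → κ} (hN : iIndepFun N P)
    (hm : ∀ i, AEMeasurable (N i) P) {f : ι → κ → ℝ≥0∞} (hf : ∀ i, Measurable (f i)) :
    ∫⁻ ω, ∏ i, f i (N i ω) ∂P = ∏ i, ∫⁻ ω, f i (N i ω) ∂P := by
  have := hN.isProbabilityMeasure
  have hp : ∀ i, IsProbabilityMeasure (P.map (N i)) := fun i =>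
    Measure.isProbabilityMeasure_map (hm i)
  have hind : iIndepFun (fun i (x : ι → κ) => f i (x i)) (Measure.pi fun i => P.map (N i)) :=
    iIndepFun_pi (fun i => (hf i).aemeasurable)
  have hmap : ∫⁻ ω, ∏ i, f i (N i ω) ∂P =
      ∫⁻ x, ∏ i, f i (x i) ∂(Measure.pi fun i => P.map (N i)) := by
    have hprod : Measurable fun x : ι → κ => ∏ i, f i (x i) :=
      Finset.measurable_prod _ fun i _ => (hf i).comp (measurable_pi_apply i)
    rw [← hN.map_fun_eq_pi_map hm, lintegral_map' hprod.aemeasurable (aemeasurable_pi_lambda _ hm)]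
  rw [hmap, lintegral_prod_eq_prod_lintegral_of_indepFun univ _ hind (by fun_prop)]
  refine Finset.prod_congr rfl fun i _ => ?_
  rw [← lintegral_map' (f := f i) (by fun_prop) (hm i)]
  have h := (measurePreserving_eval (fun i => P.map (N i)) i)
  exact h.lintegral_comp (hf i)

variable {Ω E F : Type*} [MeasurableSpace Ω] [MeasurableSpace E] [MeasurableSpace F]
  {X : ℕ → Ω → E} {ν : Measure E} {P : Measure Ω}

lemma IsPoissonPointProcess.lintegral_comp_pointCount (hX : IsPoissonPointProcess X ν P)
    {B : Set E} (hB : MeasurableSet B) (hνB : ν B ≠ ⊤) (f : ℕ∞ → ℝ≥0∞) :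
    ∫⁻ ω, f (pointCount X B ω) ∂P = ∫⁻ n : ℕ, f n ∂(poissonMeasure (ν B).toNNReal) := by
  have h := hX.poisson B hB hνB
  rw [← lintegral_map' (f := f) (Measurable.of_discrete.aemeasurable) h.aemeasurable, h.map_eq,
    lintegral_map Measurable.of_discrete Measurable.of_discrete]

lemma IsPoissonPointProcess.ae_finite (hX : IsPoissonPointProcess X ν P)
    {B : Set E} (hB : MeasurableSet B) (hνB : ν B ≠ ⊤) :
    ∀ᵐ ω ∂P, {n | X n ω ∈ B}.Finite := by
  have h := hX.poisson B hB hνB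
  have h1 : ∀ᵐ m ∂(P.map (pointCount X B)), m ≠ ⊤ := by
    rw [h.map_eq, ae_map_iff Measurable.of_discrete.aemeasurable (MeasurableSet.of_discrete)]
    exact ae_of_all _ fun n => ENat.natCast_ne_top n
  filter_upwards [ae_of_ae_map h.aemeasurable h1] with ω hω
  exact Set.encard_ne_top_iff.1 hω

lemma IsPoissonPointProcess.iIndepFun_pointCount (hX : IsPoissonPointProcess X ν P)
    {ι : Type*} [Fintype ι] {B : ι → Set E} (hB : ∀ i, MeasurableSet (B i))
    (hd : Pairwise fun i j => Disjoint (B i) (B j)) :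
    iIndepFun (fun i => pointCount X (B i)) P := by
  have h := hX.indep (Fintype.card ι) (fun i => B ((Fintype.equivFin ι).symm i)) (fun i => hB _)
    (fun i j hij => hd ((Fintype.equivFin ι).symm.injective.ne hij))
  have h2 := h.precomp (Fintype.equivFin ι).injective
  simpa using h2

lemma antitone_prod_range_of_le_one {f : ℕ → ℝ≥0∞} (hf : ∀ n, f n ≤ 1) :
    Antitone fun N => ∏ n ∈ range N, f n := by
  refine antitone_nat_of_succ_le fun N => ?_
  rw [prod_range_succ]
  exact mul_le_of_le_one_right' (hf N)

/-- Over a process with finitely many points in the support of a simple function, the product of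
`1 - g` over the points groups by the values of `g`. -/
lemma iInf_prod_range_simpleFunc {g : SimpleFunc E ℝ≥0∞} (x : ℕ → E)
    (hfin : ∀ c ∈ g.range.erase 0, {n | x n ∈ g ⁻¹' {c}}.Finite) :
    ⨅ N, ∏ n ∈ range N, (1 - g (x n)) =
      ∏ c : ↥(g.range.erase 0),
        (1 - (c : ℝ≥0∞)) ^ ({n | x n ∈ g ⁻¹' {(c : ℝ≥0∞)}}.encard.toNat) := by
  classical
  have hT : {n | g (x n) ≠ 0}.Finite := by
    refine ((g.range.erase 0).finite_toSet.biUnion (t := fun c => {n | x n ∈ g ⁻¹' {c}})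
      fun c hc => hfin c hc).subset fun n hn => ?_
    simp only [Set.mem_iUnion]
    exact ⟨g (x n), by simpa using hn, rfl⟩
  obtain ⟨N₀, hN₀⟩ : ∃ N₀, hT.toFinset ⊆ range N₀ := by
    obtain ⟨b, hb⟩ := hT.toFinset.bddAbove
    exact ⟨b + 1, fun n hn => by simpa [Nat.lt_succ_iff] using hb hn⟩
  have hprod : ∀ N, hT.toFinset ⊆ range N →
      ∏ n ∈ range N, (1 - g (x n)) = ∏ n ∈ hT.toFinset, (1 - g (x n)) := by
    intro N hN
    refine (prod_subset hN fun n _ hn => ?_).symm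
    have : g (x n) = 0 := by simpa using hn
    simp [this]
  have hinf : ⨅ N, ∏ n ∈ range N, (1 - g (x n)) = ∏ n ∈ hT.toFinset, (1 - g (x n)) := by
    refine le_antisymm ((iInf_le _ N₀).trans_eq (hprod N₀ hN₀)) (le_iInf fun N => ?_)
    rw [← hprod (max N N₀) (hN₀.trans (range_mono (le_max_right _ _)))]
    exact antitone_prod_range_of_le_one (fun n => tsub_le_self) (le_max_left N N₀)
  rw [hinf, prod_coe_sort (g.range.erase 0)
    (fun c => (1 - c) ^ ({n | x n ∈ g ⁻¹' {c}}.encard.toNat)),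
    ← prod_fiberwise_of_maps_to (s := hT.toFinset) (t := g.range.erase 0)
      (g := fun n => g (x n)) (fun n hn => by simpa using hn)]
  refine prod_congr rfl fun c hc => ?_
  have hset : {n | x n ∈ g ⁻¹' {c}} = ↑(hT.toFinset.filter fun n => g (x n) = c) := by
    ext n
    have hc0 : c ≠ 0 := (mem_erase.1 hc).1
    simp only [Set.mem_preimage, Set.mem_singleton_iff, Set.mem_ofPred_eq, coe_filter,
      Set.Finite.mem_toFinset]
    exact ⟨fun h => ⟨h ▸ hc0, h⟩, fun h => h.2⟩
  rw [hset, Set.encard_coe_eq_coe_finsetCard, ENat.toNat_natCast, ← prod_const]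
  exact prod_congr rfl fun n hn => by rw [(mem_filter.1 hn).2]

/-- Exponents live in `EReal` so that an infinite mean is allowed, `EReal.exp` sending -∞ to 0; that
case later forces a positive gain to exist. -/
lemma ereal_exp_neg_sum {ι : Type*} (s : Finset ι) (a : ι → ℝ≥0∞) :
    EReal.exp (-((∑ i ∈ s, a i : ℝ≥0∞) : EReal)) = ∏ i ∈ s, EReal.exp (-(a i : EReal)) := by
  classical
  induction s using Finset.induction_on with
  | empty => simp
  | insert i s hi ih =>
    rw [sum_insert hi, prod_insert hi, ← ih, EReal.coe_ennreal_add, ← EReal.exp_add,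
      EReal.neg_add (by simp) (by simp), sub_eq_add_neg]

/-- Grouping points by the value c of g gives ∏ (1 - c)^(N_c), where the counts N_c of the disjoint
level sets are independent Poisson; each factor has mean exp(-c ν(g = c)). The value 0 is dropped:
it contributes nothing to either side, and its level set may have infinite mass. -/
lemma IsPoissonPointProcess.lintegral_iInf_prod_simpleFunc (hX : IsPoissonPointProcess X ν P)
    {g : SimpleFunc E ℝ≥0∞} (hg1 : ∀ x, g x ≤ 1) (hg : ∀ c ∈ g.range.erase 0, ν (g ⁻¹' {c}) ≠ ⊤) :
    ∫⁻ ω, ⨅ N, ∏ n ∈ range N, (1 - g (X n ω)) ∂P =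
      EReal.exp (-((∫⁻ x, g x ∂ν : ℝ≥0∞) : EReal)) := by
  -- `toNat` sends an infinite count to 0, so the grouping identity is only available where all the
  -- counts are finite.
  have hae : ∀ᵐ ω ∂P, ∀ c : ↥(g.range.erase 0), {n | X n ω ∈ g ⁻¹' {(c : ℝ≥0∞)}}.Finite :=
    ae_all_iff.2 fun c => hX.ae_finite (g.measurableSet_preimage _) (hg c c.2)
  have h1 : ∫⁻ ω, ⨅ N, ∏ n ∈ range N, (1 - g (X n ω)) ∂P =
      ∫⁻ ω, ∏ c : ↥(g.range.erase 0),
        (fun m : ℕ∞ => (1 - (c : ℝ≥0∞)) ^ m.toNat) (pointCount X (g ⁻¹' {(c : ℝ≥0∞)}) ω) ∂P := by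
    refine lintegral_congr_ae (hae.mono fun ω hω => ?_)
    exact iInf_prod_range_simpleFunc (fun n => X n ω) fun c hc => hω ⟨c, hc⟩
  have hind := hX.iIndepFun_pointCount (B := fun c : ↥(g.range.erase 0) => g ⁻¹' {(c : ℝ≥0∞)})
    (fun c => g.measurableSet_preimage _)
    (fun c d hcd => (Set.disjoint_singleton.2 (Subtype.coe_injective.ne hcd)).preimage g)
  rw [h1, lintegral_prod_comp_of_iIndepFun hind
    (fun c => (hX.poisson _ (g.measurableSet_preimage _) (hg c c.2)).aemeasurable)
    (f := fun (c : ↥(g.range.erase 0)) (m : ℕ∞) => (1 - (c : ℝ≥0∞)) ^ m.toNat)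
    (fun c => Measurable.of_discrete)]
  have h2 : ∫⁻ x, g x ∂ν = ∑ c : ↥(g.range.erase 0), (c : ℝ≥0∞) * ν (g ⁻¹' {(c : ℝ≥0∞)}) := by
    rw [SimpleFunc.lintegral_eq_lintegral, SimpleFunc.lintegral,
      sum_coe_sort (g.range.erase 0) (fun c => c * ν (g ⁻¹' {c}))]
    by_cases h0 : (0 : ℝ≥0∞) ∈ g.range
    · rw [← Finset.add_sum_erase _ _ h0]; simp
    · rw [Finset.erase_eq_of_notMem h0]
  rw [h2, ereal_exp_neg_sum]
  refine prod_congr rfl fun c _ => ?_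
  have hc1 : (c : ℝ≥0∞) ≤ 1 := by
    obtain ⟨x, hx⟩ := SimpleFunc.mem_range.1 (mem_erase.1 c.2).2
    rw [← hx]; exact hg1 x
  rw [hX.lintegral_comp_pointCount (g.measurableSet_preimage _) (hg c c.2)
    (fun m : ℕ∞ => (1 - (c : ℝ≥0∞)) ^ m.toNat)]
  simp only [ENat.toNat_natCast]
  rw [lintegral_pow_poissonMeasure _ hc1, ENNReal.coe_toNNReal (hg c c.2)]

lemma tendsto_prod_one_sub {ι : Type*} (s : Finset ι) {g : ℕ → ι → ℝ≥0∞} {a : ι → ℝ≥0∞}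
    (h : ∀ i, Tendsto (fun k => g k i) atTop (𝓝 (a i))) :
    Tendsto (fun k => ∏ i ∈ s, (1 - g k i)) atTop (𝓝 (∏ i ∈ s, (1 - a i))) := by
  refine ENNReal.tendsto_finsetProd_of_ne_top s (fun i _ => ?_) (fun i _ => ?_)
  · exact ENNReal.Tendsto.sub tendsto_const_nhds (h i) (Or.inl ENNReal.one_ne_top)
  · exact ne_top_of_le_ne_top ENNReal.one_ne_top tsub_le_self

/-- The probability generating functional of a Poisson point process. -/
theorem IsPoissonPointProcess.lintegral_iInf_prod [SigmaFinite ν] [IsFiniteMeasure P]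
    (hX : IsPoissonPointProcess X ν P) {g : E → ℝ≥0∞} (hg : Measurable g) (hg1 : ∀ x, g x ≤ 1) :
    ∫⁻ ω, ⨅ N, ∏ n ∈ range N, (1 - g (X n ω)) ∂P =
      EReal.exp (-((∫⁻ x, g x ∂ν : ℝ≥0∞) : EReal)) := by
  -- Simple functions increasing to g, cut off to spanning sets so that every nonzero level set has
  -- finite mass.
  let G : ℕ → SimpleFunc E ℝ≥0∞ := fun k => (SimpleFunc.eapprox g k).restrict (spanningSets ν k)
  have hGval : ∀ k x, G k x = (spanningSets ν k).indicator (SimpleFunc.eapprox g k) x := fun k x =>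
    SimpleFunc.restrict_apply _ (measurableSet_spanningSets ν k) x
  have hGmono : Monotone fun k x => G k x := by
    intro k l hkl x
    simp only [hGval]
    exact (Set.indicator_le_indicator_of_subset (monotone_spanningSets ν hkl)
      (fun _ => zero_le) x).trans
      (Set.indicator_le_indicator (SimpleFunc.monotone_eapprox g hkl x))
  have hGlim : ∀ x, Tendsto (fun k => G k x) atTop (𝓝 (g x)) := by
    intro x
    refine (SimpleFunc.tendsto_eapprox hg x).congr' ?_
    filter_upwards [eventually_ge_atTop (spanningSetsIndex ν x)] with k hk
    rw [hGval, Set.indicator_of_mem (mem_spanningSets_of_index_le ν x hk)]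
  have hGle : ∀ k x, G k x ≤ g x := fun k x =>
    (show Monotone fun k => G k x from fun k l hkl => hGmono hkl x).ge_of_tendsto (hGlim x) k
  have hGfin : ∀ k, ∀ c ∈ (G k).range.erase 0, ν (G k ⁻¹' {c}) ≠ ⊤ := by
    intro k c hc
    refine ne_top_of_le_ne_top (measure_spanningSets_lt_top ν k).ne (measure_mono fun x hx => ?_)
    by_contra hxs
    have : G k x = c := hx
    rw [hGval, Set.indicator_of_notMem hxs] at this
    exact (mem_erase.1 hc).1 this.symm
  have hanti : ∀ (N : ℕ) (ω : Ω), Antitone fun k => ∏ n ∈ range N, (1 - G k (X n ω)) :=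
    fun N ω k l hkl => prod_le_prod' fun n _ => tsub_le_tsub_left (hGmono hkl _) _
  have hpt : ∀ ω, ⨅ N, ∏ n ∈ range N, (1 - g (X n ω)) =
      ⨅ k, ⨅ N, ∏ n ∈ range N, (1 - G k (X n ω)) := by
    intro ω
    rw [iInf_comm]
    refine iInf_congr fun N => (iInf_eq_of_tendsto (hanti N ω) ?_).symm
    exact tendsto_prod_one_sub _ fun n => hGlim _
  have hmeas : ∀ k, Measurable fun ω => ⨅ N, ∏ n ∈ range N, (1 - G k (X n ω)) := by
    intro k
    refine Measurable.iInf fun N => Finset.measurable_prod _ fun n _ => ?_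
    exact measurable_const.sub ((G k).measurable.comp (hX.measurable n))
  simp_rw [hpt]
  -- Monotone convergence for a decreasing sequence needs a finite integral; the empty product N = 0
  -- bounds everything by 1.
  rw [lintegral_iInf hmeas (fun k l hkl ω => iInf_mono fun N => hanti N ω hkl)
    (by
      refine ne_top_of_le_ne_top (measure_ne_top P Set.univ)
        ((lintegral_mono (g := fun _ => 1) fun ω => ?_).trans_eq (by simp))
      exact (iInf_le _ 0).trans_eq (by simp))]
  simp_rw [fun k => hX.lintegral_iInf_prod_simpleFunc (fun x => (hGle k x).trans (hg1 x)) (hGfin k)]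
  have hI : Tendsto (fun k => ∫⁻ x, G k x ∂ν) atTop (𝓝 (∫⁻ x, g x ∂ν)) :=
    lintegral_tendsto_of_tendsto_of_monotone (fun k => (G k).measurable.aemeasurable)
      (ae_of_all _ fun x k l hkl => hGmono hkl x) (ae_of_all _ hGlim)
  refine iInf_eq_of_tendsto (fun k l hkl => ?_) ?_
  · refine EReal.exp_monotone (EReal.neg_le_neg_iff.2 ?_)
    exact_mod_cast lintegral_mono (hGmono hkl)
  · exact (ENNReal.continuous_exp.tendsto _).comp
      (continuous_neg.tendsto _ |>.comp ((continuous_coe_ennreal_ereal.tendsto _).comp hI))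

end PoissonProcess

/-! ### Independent marks: void probabilities and finiteness -/

section Marking

variable {Ω E F : Type*} [MeasurableSpace Ω] [MeasurableSpace E] [MeasurableSpace F]

/-- The marks `Y 0, Y 1, …` of the points `X 0, X 1, …` are i.i.d. with law `κ` and independent of
the points. -/
structure IsIndepMarking (X : ℕ → Ω → E) (Y : ℕ → Ω → F) (κ : Measure F) (P : Measure Ω) :
    Prop where
  measurable : ∀ n, Measurable (Y n)
  map_eq : ∀ n, P.map (Y n) = κ
  indep : iIndepFun Y P
  indep_points : IndepFun (fun ω n => X n ω) (fun ω n => Y n ω) P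

variable {X : ℕ → Ω → E} {Y : ℕ → Ω → F} {ν : Measure E} {κ : Measure F} {P : Measure Ω}

/-- Continuity from above along finite boxes. The infimum of partial products is the form in which
the generating functional is stated. -/
lemma infinitePi_forall_mem [IsProbabilityMeasure κ] {t : ℕ → Set F}
    (ht : ∀ n, MeasurableSet (t n)) :
    Measure.infinitePi (fun _ : ℕ => κ) {y | ∀ n, y n ∈ t n} = ⨅ N, ∏ n ∈ range N, κ (t n) := by
  have hset : {y : ℕ → F | ∀ n, y n ∈ t n} = ⋂ N, Set.pi (range N : Finset ℕ) t := by
    ext y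
    simp only [Set.mem_ofPred_eq, Set.mem_iInter, Set.mem_pi, coe_range, Set.mem_Iio]
    exact ⟨fun h N n _ => h n, fun h n => h (n + 1) n n.lt_succ_self⟩
  have hanti : Antitone fun N => Set.pi (range N : Finset ℕ) t := fun M N hMN =>
    Set.pi_mono' (fun _ _ => subset_rfl) (by exact_mod_cast range_mono hMN)
  rw [hset, hanti.measure_iInter (fun N => (MeasurableSet.pi (Finset.countable_toSet _)
    fun n _ => ht n).nullMeasurableSet) ⟨0, measure_ne_top _ _⟩]
  exact iInf_congr fun N => Measure.infinitePi_pi _ fun n _ => ht n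

/-- The void probabilities of an independently marked Poisson point process. -/
theorem IsPoissonPointProcess.measure_forall_notMem [SigmaFinite ν] [IsProbabilityMeasure P]
    [IsProbabilityMeasure κ] (hX : IsPoissonPointProcess X ν P) (hY : IsIndepMarking X Y κ P)
    {D : Set (E × F)} (hD : MeasurableSet D) :
    P {ω | ∀ n, (X n ω, Y n ω) ∉ D} =
      EReal.exp (-((∫⁻ x, κ (Prod.mk x ⁻¹' D) ∂ν : ℝ≥0∞) : EReal)) := by
  have hXm : Measurable fun ω n => X n ω := measurable_pi_lambda _ hX.measurable
  have hYm : Measurable fun ω n => Y n ω := measurable_pi_lambda _ hY.measurable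
  have hmapY : P.map (fun ω n => Y n ω) = Measure.infinitePi fun _ : ℕ => κ := by
    rw [hY.indep.map_fun_eq_infinitePi_map hY.measurable]
    simp_rw [hY.map_eq]
  have hmap := (indepFun_iff_map_prod_eq_prod_map_map hXm.aemeasurable hYm.aemeasurable).1
    hY.indep_points
  have hS : MeasurableSet {z : (ℕ → E) × (ℕ → F) | ∀ n, (z.1 n, z.2 n) ∉ D} := by
    have : {z : (ℕ → E) × (ℕ → F) | ∀ n, (z.1 n, z.2 n) ∉ D} =
        ⋂ n, (fun z : (ℕ → E) × (ℕ → F) => (z.1 n, z.2 n)) ⁻¹' Dᶜ := by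
      ext z; simp
    rw [this]
    refine MeasurableSet.iInter fun n => hD.compl.preimage (Measurable.prodMk ?_ ?_)
    · exact (measurable_pi_apply n).comp measurable_fst
    · exact (measurable_pi_apply n).comp measurable_snd
  have hm : Measurable fun x => κ (Prod.mk x ⁻¹' D) := measurable_measure_prodMk_left hD
  rw [← hX.lintegral_iInf_prod hm fun x => prob_le_one]
  have h1 : P {ω | ∀ n, (X n ω, Y n ω) ∉ D} =
      (P.map fun ω => ((fun n => X n ω), (fun n => Y n ω)))
        {z : (ℕ → E) × (ℕ → F) | ∀ n, (z.1 n, z.2 n) ∉ D} := by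
    rw [Measure.map_apply (hXm.prodMk hYm) hS]; rfl
  -- Fubini with the positions frozen: the marks avoid their sections with probability ∏ (1 -
  -- κ(section)).
  rw [h1, hmap, hmapY, Measure.prod_apply hS,
    lintegral_map (measurable_measure_prodMk_left hS) hXm]
  refine lintegral_congr fun ω => ?_
  have h2 : Prod.mk (fun n => X n ω) ⁻¹' {z : (ℕ → E) × (ℕ → F) | ∀ n, (z.1 n, z.2 n) ∉ D} =
      {y | ∀ n, y n ∈ (Prod.mk (X n ω) ⁻¹' D)ᶜ} := rfl
  rw [h2, infinitePi_forall_mem fun n => (hD.preimage measurable_prodMk_left).compl]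
  simp_rw [fun n => prob_compl_eq_one_sub (μ := κ)
    (hD.preimage (measurable_prodMk_left (x := X n ω)))]

lemma tendsto_lintegral_indicator_compl_spanningSets [SigmaFinite ν] {f : E → ℝ≥0∞}
    (hf : Measurable f) (hfin : ∫⁻ x, f x ∂ν ≠ ⊤) :
    Tendsto (fun k => ∫⁻ x, (spanningSets ν k)ᶜ.indicator f x ∂ν) atTop (𝓝 0) := by
  have h := tendsto_lintegral_of_dominated_convergence (μ := ν)
    (F := fun k => (spanningSets ν k)ᶜ.indicator f) (f := fun _ => 0) f
    (fun k => hf.indicator (measurableSet_spanningSets ν k).compl)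
    (fun k => ae_of_all _ fun x => Set.indicator_le_self _ _ x) hfin
    (ae_of_all _ fun x => by
      refine tendsto_const_nhds.congr' ?_
      filter_upwards [eventually_ge_atTop (spanningSetsIndex ν x)] with k hk
      rw [Set.indicator_of_notMem]
      exact fun h => h (mem_spanningSets_of_index_le ν x hk))
  simpa using h

/-- If the mean number of marked points in `D` is finite, then almost surely only finitely many
marked points lie in `D`. -/
theorem IsPoissonPointProcess.ae_finite_marked [SigmaFinite ν] [IsProbabilityMeasure P]
    [IsProbabilityMeasure κ] (hX : IsPoissonPointProcess X ν P) (hY : IsIndepMarking X Y κ P)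
    {D : Set (E × F)} (hD : MeasurableSet D) (hfin : ∫⁻ x, κ (Prod.mk x ⁻¹' D) ∂ν ≠ ⊤) :
    ∀ᵐ ω ∂P, {n | (X n ω, Y n ω) ∈ D}.Finite := by
  -- The part of D over positions outside the k-th spanning set. Its mean count tends to 0, so its
  -- void probability tends to 1, and almost surely some k leaves it empty; the remaining points lie
  -- in a set of finite mass.
  let D' : ℕ → Set (E × F) := fun k => D ∩ Prod.fst ⁻¹' (spanningSets ν k)ᶜ
  have hD' : ∀ k, MeasurableSet (D' k) := fun k =>
    hD.inter ((measurableSet_spanningSets ν k).compl.preimage measurable_fst)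
  have hvoid : ∀ k, P {ω | ∀ n, (X n ω, Y n ω) ∉ D' k} = EReal.exp
      (-((∫⁻ x, (spanningSets ν k)ᶜ.indicator (fun x => κ (Prod.mk x ⁻¹' D)) x ∂ν : ℝ≥0∞) :
        EReal)) := by
    intro k
    rw [hX.measure_forall_notMem hY (hD' k)]
    congr 4
    ext x
    by_cases hx : x ∈ spanningSets ν k
    · rw [Set.indicator_of_notMem (by simpa using hx)]
      have : Prod.mk x ⁻¹' D' k = ∅ := by ext y; simp [D', hx]
      simp [this]
    · rw [Set.indicator_of_mem (by simpa using hx)]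
      congr 1
      ext y; simp [D', hx]
  have hlim : Tendsto (fun k => P {ω | ∀ n, (X n ω, Y n ω) ∉ D' k}) atTop (𝓝 1) := by
    simp_rw [hvoid]
    have h := (ENNReal.continuous_exp.tendsto _).comp
      ((continuous_neg.tendsto _).comp ((continuous_coe_ennreal_ereal.tendsto _).comp
        (tendsto_lintegral_indicator_compl_spanningSets
          (measurable_measure_prodMk_left hD (ν := κ)) hfin)))
    simpa [Function.comp_def] using h
  have hbase : ∀ᵐ ω ∂P, ∀ k, {n | X n ω ∈ spanningSets ν k}.Finite := ae_all_iff.2 fun k =>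
    hX.ae_finite (measurableSet_spanningSets ν k) (measure_spanningSets_lt_top ν k).ne
  have hmeas : ∀ k, MeasurableSet {ω | ∀ n, (X n ω, Y n ω) ∉ D' k} := by
    intro k
    have : {ω | ∀ n, (X n ω, Y n ω) ∉ D' k} =
        ⋂ n, (fun ω => (X n ω, Y n ω)) ⁻¹' (D' k)ᶜ := by ext; simp
    rw [this]
    exact MeasurableSet.iInter fun n =>
      (hD' k).compl.preimage ((hX.measurable n).prodMk (hY.measurable n))
  have hev : ∀ᵐ ω ∂P, ∃ k, ∀ n, (X n ω, Y n ω) ∉ D' k := by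
    have hU : P (⋃ k, {ω | ∀ n, (X n ω, Y n ω) ∉ D' k}) = 1 :=
      le_antisymm prob_le_one (le_of_tendsto' hlim fun k => measure_mono
        (Set.subset_iUnion (fun k => {ω | ∀ n, (X n ω, Y n ω) ∉ D' k}) k))
    have := (prob_compl_eq_zero_iff (MeasurableSet.iUnion hmeas)).2 hU
    rw [ae_iff]
    convert this using 2
    ext; simp
  filter_upwards [hbase, hev] with ω hω ⟨k, hk⟩
  refine (hω k).subset fun n hn => ?_
  by_contra hx
  exact hk n ⟨hn, hx⟩

end Marking

/-! ### Channel gains: exponential and Erlang laws -/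

section Channel

lemma lintegral_Ioi_mul_exp_neg_sq {s : ℝ} (hs : 0 ≤ s) :
    ∫⁻ r in Set.Ioi (√s), ENNReal.ofReal (2 * r * Real.exp (-r ^ 2)) =
      ENNReal.ofReal (Real.exp (-s)) := by
  have hd : ∀ x ∈ Set.Ici (√s), HasDerivAt (fun r : ℝ => -Real.exp (-r ^ 2))
      (2 * x * Real.exp (-x ^ 2)) x := by
    intro x _
    have h := ((hasDerivAt_pow 2 x).neg.exp).neg
    refine h.congr_deriv ?_
    simp; ring
  have hpos : ∀ x ∈ Set.Ioi (√s), 0 ≤ 2 * x * Real.exp (-x ^ 2) := by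
    intro x hx
    have : 0 ≤ x := (Real.sqrt_nonneg s).trans (le_of_lt hx)
    positivity
  have hlim : Tendsto (fun r : ℝ => -Real.exp (-r ^ 2)) atTop (𝓝 0) := by
    have h := (Real.tendsto_exp_neg_atTop_nhds_zero.comp
      (tendsto_pow_atTop (α := ℝ) two_ne_zero)).neg
    simpa [Function.comp_def] using h
  rw [← ofReal_integral_eq_lintegral_ofReal (integrableOn_Ioi_deriv_of_nonneg' hd hpos hlim)
    ((ae_restrict_iff' measurableSet_Ioi).2 (ae_of_all _ hpos)),
    integral_Ioi_of_hasDerivAt_of_nonneg' hd hpos hlim]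
  simp [Real.sq_sqrt hs]

instance : IsProbabilityMeasure stdComplexGaussian := by
  unfold stdComplexGaussian
  exact Measure.isProbabilityMeasure_map
    (Complex.measurableEquivRealProd.symm.measurable.aemeasurable)

/-- The joint density π⁻¹ exp(-(x² + y²)) is radial. In polar coordinates it splits as 2r exp(-r²)
times the uniform angular density 1/(2π), and the radial factor has primitive -exp(-r²). -/
lemma stdComplexGaussian_lt_norm_sq {s : ℝ} (hs : 0 ≤ s) :
    stdComplexGaussian {z | s < ‖z‖ ^ 2} = ENNReal.ofReal (Real.exp (-s)) := by
  have hmk : Measurable fun z : ℝ × ℝ => (⟨z.1, z.2⟩ : ℂ) :=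
    Complex.measurableEquivRealProd.symm.measurable
  have hS : MeasurableSet {z : ℂ | s < ‖z‖ ^ 2} := measurableSet_lt (by fun_prop) (by fun_prop)
  have hS' : MeasurableSet {z : ℝ × ℝ | s < z.1 ^ 2 + z.2 ^ 2} :=
    measurableSet_lt (by fun_prop) (by fun_prop)
  have hpre : (fun z : ℝ × ℝ => (⟨z.1, z.2⟩ : ℂ)) ⁻¹' {z | s < ‖z‖ ^ 2} =
      {z | s < z.1 ^ 2 + z.2 ^ 2} := by
    ext z
    rw [Set.mem_preimage, Set.mem_ofPred_eq, Set.mem_ofPred_eq, Complex.sq_norm,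
      Complex.normSq_apply, sq, sq]
  have hpdf : ∀ z : ℝ × ℝ, gaussianPDF 0 (1 / 2) z.1 * gaussianPDF 0 (1 / 2) z.2 =
      ENNReal.ofReal (Real.pi⁻¹ * Real.exp (-(z.1 ^ 2 + z.2 ^ 2))) := by
    intro z
    rw [gaussianPDF, gaussianPDF, ← ENNReal.ofReal_mul (gaussianPDFReal_nonneg _ _ _)]
    congr 1
    simp only [gaussianPDFReal, NNReal.coe_div, NNReal.coe_one, NNReal.coe_ofNat]
    have h1 : 2 * Real.pi * (1 / 2) = Real.pi := by ring
    have h2 : (√Real.pi)⁻¹ * (√Real.pi)⁻¹ = Real.pi⁻¹ := by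
      rw [← mul_inv, Real.mul_self_sqrt Real.pi_nonneg]
    rw [h1, neg_add, Real.exp_add, ← h2]
    norm_num
    ring
  have hv : (1 / 2 : ℝ≥0) ≠ 0 := by norm_num
  unfold stdComplexGaussian
  rw [Measure.map_apply hmk hS, hpre, gaussianReal_of_var_ne_zero _ hv,
    prod_withDensity (measurable_gaussianPDF _ _) (measurable_gaussianPDF _ _),
    withDensity_apply _ hS', ← lintegral_indicator hS']
  simp_rw [hpdf]
  rw [← Measure.volume_eq_prod, ← lintegral_comp_polarCoord_symm]
  have hcongr : ∀ q ∈ polarCoord.target, ENNReal.ofReal q.1 •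
      ({z : ℝ × ℝ | s < z.1 ^ 2 + z.2 ^ 2}.indicator
      (fun z => ENNReal.ofReal (Real.pi⁻¹ * Real.exp (-(z.1 ^ 2 + z.2 ^ 2)))) (polarCoord.symm q)) =
      (Set.Ioi (√s)).indicator (fun r => ENNReal.ofReal (2 * r * Real.exp (-r ^ 2))) q.1 *
        ENNReal.ofReal (2 * Real.pi)⁻¹ := by
    rintro ⟨r, θ⟩ hq
    have hr : 0 < r := hq.1
    have hsq : (r * Real.cos θ) ^ 2 + (r * Real.sin θ) ^ 2 = r ^ 2 := by
      linear_combination r ^ 2 * Real.cos_sq_add_sin_sq θ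
    by_cases h : √s < r
    · have h' : s < r ^ 2 := (Real.sqrt_lt' hr).1 h
      rw [Set.indicator_of_mem (by simpa [hsq] using h'), Set.indicator_of_mem (by simpa using h)]
      simp only [polarCoord_symm_apply, hsq, smul_eq_mul]
      rw [← ENNReal.ofReal_mul hr.le, ← ENNReal.ofReal_mul (by positivity)]
      congr 1
      field_simp
    · have h' : ¬ s < r ^ 2 := fun h' => h ((Real.sqrt_lt' hr).2 h')
      rw [Set.indicator_of_notMem (by simpa [hsq] using h'),
        Set.indicator_of_notMem (by simpa using h)]
      simp
  rw [setLIntegral_congr_fun polarCoord.open_target.measurableSet hcongr, polarCoord_target,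
    Measure.volume_eq_prod, ← Measure.prod_restrict]
  have hmeas : Measurable ((Set.Ioi (√s)).indicator
      fun r => ENNReal.ofReal (2 * r * Real.exp (-r ^ 2))) :=
    Measurable.indicator (by fun_prop) measurableSet_Ioi
  rw [lintegral_prod_mul (f := (Set.Ioi (√s)).indicator
      fun r => ENNReal.ofReal (2 * r * Real.exp (-r ^ 2)))
      (g := fun _ => ENNReal.ofReal (2 * Real.pi)⁻¹) hmeas.aemeasurable aemeasurable_const,
    lintegral_indicator measurableSet_Ioi, Measure.restrict_restrict measurableSet_Ioi,
    Set.inter_eq_left.2 (Set.Ioi_subset_Ioi (Real.sqrt_nonneg s)), lintegral_Ioi_mul_exp_neg_sq hs]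
  have : ENNReal.ofReal (2 * Real.pi)⁻¹ * ENNReal.ofReal (2 * Real.pi) = 1 := by
    rw [← ENNReal.ofReal_mul (by positivity), inv_mul_cancel₀ (by positivity), ENNReal.ofReal_one]
  simp only [lintegral_const, Measure.restrict_apply_univ, Real.volume_Ioo]
  rw [show Real.pi - -Real.pi = 2 * Real.pi by ring, this, mul_one]

instance : IsProbabilityMeasure (expMeasure 1) := isProbabilityMeasure_expMeasure one_pos

/-- The squared modulus of a standard complex Gaussian is exponentially distributed. -/
lemma map_norm_sq_stdComplexGaussian :
    stdComplexGaussian.map (fun z => ‖z‖ ^ 2) = expMeasure 1 := by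
  have hm : Measurable fun z : ℂ => ‖z‖ ^ 2 := by fun_prop
  have : IsProbabilityMeasure (stdComplexGaussian.map fun z : ℂ => ‖z‖ ^ 2) :=
    Measure.isProbabilityMeasure_map hm.aemeasurable
  refine Measure.eq_of_cdf _ _ ?_
  ext x
  rw [cdf_expMeasure_eq one_pos, cdf_eq_real, map_measureReal_apply hm measurableSet_Iic]
  split_ifs with hx
  · have hset : (fun z : ℂ => ‖z‖ ^ 2) ⁻¹' Set.Iic x = {z | x < ‖z‖ ^ 2}ᶜ := by
      ext z; simp
    have hS : MeasurableSet {z : ℂ | x < ‖z‖ ^ 2} := measurableSet_lt (by fun_prop) (by fun_prop)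
    rw [hset, probReal_compl_eq_one_sub hS, measureReal_def, stdComplexGaussian_lt_norm_sq hx,
      ENNReal.toReal_ofReal (Real.exp_nonneg _), one_mul]
  · have hset : (fun z : ℂ => ‖z‖ ^ 2) ⁻¹' Set.Iic x = ∅ := by
      ext z
      simp only [Set.mem_preimage, Set.mem_Iic, Set.mem_empty_iff_false, iff_false, not_le]
      exact (not_le.1 hx).trans_le (by positivity)
    simp [hset]

/-- Tail of the Erlang distribution of shape `M` and rate one. -/
noncomputable def erlangTail (M : ℕ) (s : ℝ) : ℝ :=
  Real.exp (-s) * ∑ m ∈ range M, s ^ m / (m.factorial : ℝ)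

lemma erlangTail_nonneg (M : ℕ) {s : ℝ} (hs : 0 ≤ s) : 0 ≤ erlangTail M s := by
  unfold erlangTail; positivity

@[fun_prop]
lemma continuous_erlangTail (M : ℕ) : Continuous (erlangTail M) := by
  unfold erlangTail; fun_prop

/-- The convolution in the Erlang induction: exp(-e) exp(-(s - e)) does not depend on e, so only
powers of s - e are integrated. -/
lemma integral_exp_neg_mul_erlangTail (M : ℕ) (s : ℝ) :
    ∫ e in (0 : ℝ)..s, Real.exp (-e) * erlangTail M (s - e) =
      Real.exp (-s) * ∑ m ∈ range M, s ^ (m + 1) / ((m + 1).factorial : ℝ) := by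
  have h1 : ∀ e, Real.exp (-e) * erlangTail M (s - e) =
      Real.exp (-s) * ∑ m ∈ range M, (s - e) ^ m / (m.factorial : ℝ) := by
    intro e
    rw [erlangTail, ← mul_assoc, ← Real.exp_add]
    congr 2; ring
  simp_rw [h1]
  rw [intervalIntegral.integral_const_mul, intervalIntegral.integral_finsetSum
    (fun m _ => (by fun_prop :
      Continuous fun e : ℝ => (s - e) ^ m / (m.factorial : ℝ)).intervalIntegrable _ _)]
  congr 1
  refine sum_congr rfl fun m _ => ?_
  rw [intervalIntegral.integral_div, intervalIntegral.integral_comp_sub_left (fun x => x ^ m) s,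
    integral_pow, Nat.factorial_succ]
  push_cast
  simp
  field_simp

lemma lintegral_expMeasure (f : ℝ → ℝ≥0∞) (hf : Measurable f) :
    ∫⁻ e, f e ∂(expMeasure 1) = ∫⁻ e in Set.Ici 0, ENNReal.ofReal (Real.exp (-e)) * f e := by
  have hpdf : (fun e => gammaPDF 1 1 e * f e) =
      (Set.Ici 0).indicator fun e => ENNReal.ofReal (Real.exp (-e)) * f e := by
    ext e
    by_cases he : 0 ≤ e
    · rw [Set.indicator_of_mem (by simpa using he), gammaPDF_of_nonneg he]
      simp
    · rw [Set.indicator_of_notMem (by simpa using he), gammaPDF_of_neg (not_le.1 he), zero_mul]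
  have hm : Measurable (gammaPDF 1 1) := (measurable_gammaPDFReal 1 1).ennreal_ofReal
  rw [expMeasure, gammaMeasure, lintegral_withDensity_eq_lintegral_mul _ hm hf,
    ← lintegral_indicator measurableSet_Ici, ← hpdf]
  rfl

/-- The sum of `M` independent unit exponential variables has the Erlang tail. -/
lemma pi_expMeasure_lt_sum (M : ℕ) : ∀ s : ℝ,
    (Measure.pi fun _ : Fin M => expMeasure 1) {x | s < ∑ i, x i} =
      if 0 ≤ s then ENNReal.ofReal (erlangTail M s) else 1 := by
  induction M with
  | zero =>
    intro s
    split_ifs with hs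
    · simp [erlangTail, hs.not_gt]
    · simp [not_le.1 hs]
  | succ M ih =>
    have hpos : ∀ s : ℝ, 0 ≤ s →
        (Measure.pi fun _ : Fin (M + 1) => expMeasure 1) {x | s < ∑ i, x i} =
          ENNReal.ofReal (erlangTail (M + 1) s) := by
      intro s hs
      have hS : MeasurableSet {z : ℝ × (Fin M → ℝ) | s < z.1 + ∑ i, z.2 i} :=
        measurableSet_lt (by fun_prop) (by fun_prop)
      have hmp := measurePreserving_piFinSuccAbove (fun _ : Fin (M + 1) => expMeasure 1) 0
      have hpre : {x : Fin (M + 1) → ℝ | s < ∑ i, x i} =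
          MeasurableEquiv.piFinSuccAbove (fun _ => ℝ) 0 ⁻¹'
            {z : ℝ × (Fin M → ℝ) | s < z.1 + ∑ i, z.2 i} := by
        ext x
        simp only [Fin.sum_univ_succ]
        rfl
      rw [hpre, hmp.measure_preimage hS.nullMeasurableSet, Measure.prod_apply hS]
      have hsec : ∀ e : ℝ, (Measure.pi fun _ : Fin M => expMeasure 1)
          (Prod.mk e ⁻¹' {z : ℝ × (Fin M → ℝ) | s < z.1 + ∑ i, z.2 i}) =
          if e ≤ s then ENNReal.ofReal (erlangTail M (s - e)) else 1 := by
        intro e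
        rw [show Prod.mk e ⁻¹' {z : ℝ × (Fin M → ℝ) | s < z.1 + ∑ i, z.2 i} =
          {x | s - e < ∑ i, x i} by ext x; simp [sub_lt_iff_lt_add'], ih]
        simp only [sub_nonneg]
      have hmeas : Measurable fun e : ℝ =>
          if e ≤ s then ENNReal.ofReal (erlangTail M (s - e)) else (1 : ℝ≥0∞) :=
        Measurable.ite measurableSet_Iic (by fun_prop) measurable_const
      -- If the first variable e is at most s, the others must exceed s - e, which yields the terms
      -- m ≥ 1 of the new tail; if e > s the event is almost sure, which yields the term m = 0.
      have hsplit : Set.Ici (0 : ℝ) = Set.Icc 0 s ∪ Set.Ioi s := (Set.Icc_union_Ioi_eq_Ici hs).symm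
      have hI : ∫⁻ e in Set.Icc 0 s, ENNReal.ofReal (Real.exp (-e)) *
          (if e ≤ s then ENNReal.ofReal (erlangTail M (s - e)) else 1) =
          ENNReal.ofReal (∫ e in (0 : ℝ)..s, Real.exp (-e) * erlangTail M (s - e)) := by
        rw [setLIntegral_congr_fun measurableSet_Icc (g := fun e =>
          ENNReal.ofReal (Real.exp (-e) * erlangTail M (s - e))) (fun e he => by
            simp only [if_pos he.2, ENNReal.ofReal_mul (Real.exp_nonneg _)])]
        have hc : Continuous fun e : ℝ => Real.exp (-e) * erlangTail M (s - e) := by fun_prop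
        rw [intervalIntegral.integral_of_le hs, ← integral_Icc_eq_integral_Ioc,
          ofReal_integral_eq_lintegral_ofReal hc.continuousOn.integrableOn_Icc]
        refine (ae_restrict_iff' measurableSet_Icc).2 (ae_of_all _ fun e he => ?_)
        exact mul_nonneg (Real.exp_nonneg _) (erlangTail_nonneg M (sub_nonneg.2 he.2))
      have hT : ∫⁻ e in Set.Ioi s, ENNReal.ofReal (Real.exp (-e)) *
          (if e ≤ s then ENNReal.ofReal (erlangTail M (s - e)) else 1) =
          ENNReal.ofReal (Real.exp (-s)) := by
        rw [setLIntegral_congr_fun measurableSet_Ioi (g := fun e => ENNReal.ofReal (Real.exp (-e)))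
          (fun e he => by
            simp only [if_neg (not_le.2 (Set.mem_Ioi.1 he)), mul_one]),
          ← ofReal_integral_eq_lintegral_ofReal 
            (by simpa [IntegrableOn] using exp_neg_integrableOn_Ioi s one_pos)
          (ae_of_all _ fun e => Real.exp_nonneg _), integral_exp_neg_Ioi]
      simp_rw [hsec]
      rw [lintegral_expMeasure _ hmeas, hsplit, lintegral_union measurableSet_Ioi
        (Set.disjoint_left.2 fun e he he' => not_lt.2 he.2 he'), hI, hT,
        integral_exp_neg_mul_erlangTail, ← ENNReal.ofReal_add (by positivity) (Real.exp_nonneg _),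
        erlangTail, sum_range_succ']
      congr 1
      simp; ring
    intro s
    split_ifs with hs
    · exact hpos s hs
    · refine le_antisymm prob_le_one ?_
      -- For negative s the event contains the one for s = 0, which already has probability 1.
      have h0 : erlangTail (M + 1) 0 = 1 := by simp [erlangTail, sum_range_succ']
      have h1 := hpos 0 le_rfl
      rw [h0, ENNReal.ofReal_one] at h1
      rw [← h1]
      exact measure_mono fun x hx => (not_le.1 hs).trans hx

/-- The Erlang law: the law of a sum of `M` independent unit exponential variables. -/
noncomputable def erlang (M : ℕ) : Measure ℝ :=
  (Measure.pi fun _ : Fin M => expMeasure 1).map fun x => ∑ i, x i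

instance (M : ℕ) : IsProbabilityMeasure (erlang M) :=
  Measure.isProbabilityMeasure_map (Measurable.aemeasurable (by fun_prop))

lemma erlang_Ioi (M : ℕ) {s : ℝ} (hs : 0 ≤ s) :
    erlang M (Set.Ioi s) = ENNReal.ofReal (erlangTail M s) := by
  rw [erlang, Measure.map_apply (by fun_prop) measurableSet_Ioi]
  exact (pi_expMeasure_lt_sum M s).trans (if_pos hs)

/-- Squeezed by open half-lines from u < s, using continuity of the tail. Positivity of s matters:
for M = 0 the law is the Dirac mass at 0. -/
lemma erlang_Ici (M : ℕ) {s : ℝ} (hs : 0 < s) :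
    erlang M (Set.Ici s) = ENNReal.ofReal (erlangTail M s) := by
  refine le_antisymm ?_ ((erlang_Ioi M hs.le).symm.le.trans (measure_mono Set.Ioi_subset_Ici_self))
  have hlim : Tendsto (fun u => ENNReal.ofReal (erlangTail M u)) (𝓝[<] s)
      (𝓝 (ENNReal.ofReal (erlangTail M s))) :=
    ((ENNReal.continuous_ofReal.comp (continuous_erlangTail M)).tendsto s).mono_left
      nhdsWithin_le_nhds
  refine ge_of_tendsto hlim ?_
  filter_upwards [Ioo_mem_nhdsLT hs] with u hu
  rw [← erlang_Ioi M hu.1.le]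
  exact measure_mono (Set.Ici_subset_Ioi.2 hu.2)

variable {Ω : Type*} [MeasurableSpace Ω] {P : Measure Ω}

/-- The rows of an array of independent variables are independent. -/
lemma iIndepFun_curry {ι κ 𝓧 : Type*} [MeasurableSpace 𝓧] {Z : ι × κ → Ω → 𝓧}
    (mZ : ∀ q, Measurable (Z q)) (hZ : iIndepFun Z P) : iIndepFun (fun i ω j => Z (i, j) ω) P := by
  have := hZ.isProbabilityMeasure
  have h1 : ∀ q, IsProbabilityMeasure (P.map (Z q)) := fun q =>
    Measure.isProbabilityMeasure_map (mZ q).aemeasurable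
  have hrow : ∀ i, P.map (fun ω j => Z (i, j) ω) =
      Measure.infinitePi fun j => P.map (Z (i, j)) := fun i =>
    (hZ.precomp (Prod.mk_right_injective i)).map_fun_eq_infinitePi_map fun j => mZ (i, j)
  rw [iIndepFun_iff_map_fun_eq_infinitePi_map
    (fun i => measurable_pi_lambda _ fun j => mZ (i, j))]
  simp_rw [hrow]
  rw [← Measure.infinitePi_map_curry (fun i j => P.map (Z (i, j))),
    ← hZ.map_fun_eq_infinitePi_map mZ,
    Measure.map_map (MeasurableEquiv.measurable _) (measurable_pi_lambda _ mZ)]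
  rfl

variable {M : ℕ} {lam : ℝ}
  {X : ℕ → Ω → Plane} {h : ℕ → Ω → EuclideanSpace ℂ (Fin M)}

/-- The squared channel norms are independent Erlang marks of the beacons. -/
lemma IsBeaconField.isIndepMarking (hX : IsBeaconField lam X h P) :
    IsIndepMarking X (fun n ω => ‖h n ω‖ ^ 2) (erlang M) P := by
  have hP := hX.indep_channel.isProbabilityMeasure
  have hm : ∀ n m, Measurable fun ω => h n ω m := fun n m =>
    (EuclideanSpace.proj (𝕜 := ℂ) m).continuous.measurable.comp (hX.measurable_channel n)
  have hnorm : ∀ n ω, ‖h n ω‖ ^ 2 = ∑ m, ‖h n ω m‖ ^ 2 := fun n ω => EuclideanSpace.norm_sq_eq _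
  refine ⟨fun n => (hX.measurable_channel n).norm.pow_const 2, fun n => ?_, ?_, ?_⟩
  · have hind : iIndepFun (fun (m : Fin M) ω => ‖h n ω m‖ ^ 2) P :=
      (hX.indep_channel.precomp (Prod.mk_right_injective n)).comp (fun _ z => ‖z‖ ^ 2)
        (fun _ => by fun_prop)
    have hlaw : ∀ m, P.map (fun ω => ‖h n ω m‖ ^ 2) = expMeasure 1 := by
      intro m
      rw [← map_norm_sq_stdComplexGaussian, ← (hX.law_channel n m).map_eq,
        Measure.map_map (by fun_prop) (hm n m)]
      rfl
    have hpi := hind.map_fun_eq_pi_map fun m => ((hm n m).norm.pow_const 2).aemeasurable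
    simp_rw [hlaw] at hpi
    rw [erlang, ← hpi, Measure.map_map (by fun_prop)
      (measurable_pi_lambda _ fun m => (hm n m).norm.pow_const 2)]
    congr 1
    ext ω
    exact hnorm n ω
  · have hind := (iIndepFun_curry (Z := fun q : ℕ × Fin M => fun ω => h q.1 ω q.2)
      (fun q => hm q.1 q.2) hX.indep_channel).comp (fun _ z => ∑ m, ‖z m‖ ^ 2)
        (fun _ => by fun_prop)
    convert hind using 2 with n
    ext ω
    exact hnorm n ω
  · refine hX.indep_position_channel.comp measurable_id
      (ψ := fun (z : ℕ → EuclideanSpace ℂ (Fin M)) n => ‖z n‖ ^ 2) ?_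
    exact measurable_pi_lambda _ fun n => (measurable_pi_apply n).norm.pow_const 2

end Channel

/-! ### The radial integral and the incomplete Gamma function -/

section RadialIntegral

/-- Each term t^m exp(-t)/m! of the tail shifts the exponent δ - 1 to m + δ - 1. The cutoff at c
stays an indicator on (0, ∞), the domain used by the later changes of variables. -/
lemma integrableOn_rpow_mul_erlangTail (M : ℕ) {δ c : ℝ} (hδ : 0 < δ) (hc : 0 < c) :
    IntegrableOn (fun t => t ^ (δ - 1) * (Set.Ici c).indicator (erlangTail M) t) (Set.Ioi 0) ∧
      ∫ t in Set.Ioi 0, t ^ (δ - 1) * (Set.Ici c).indicator (erlangTail M) t =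
        ∑ m ∈ range M, upperGamma (m + δ) c / (m.factorial : ℝ) := by
  have hint : ∀ m : ℕ,
      IntegrableOn (fun t : ℝ => t ^ ((m + δ) - 1) * Real.exp (-t)) (Set.Ioi c) := by
    intro m
    refine ((Real.GammaIntegral_convergent (by positivity : 0 < (m : ℝ) + δ)).mono_set
      (Set.Ioi_subset_Ioi hc.le)).congr_fun (fun t _ => mul_comm _ _) measurableSet_Ioi
  have heq : (fun t : ℝ => t ^ (δ - 1) * (Set.Ici c).indicator (erlangTail M) t) =
      (Set.Ici c).indicator fun t =>
        ∑ m ∈ range M, t ^ ((m + δ) - 1) * Real.exp (-t) / (m.factorial : ℝ) := by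
    ext t
    by_cases ht : c ≤ t
    · have ht0 : 0 < t := hc.trans_le ht
      rw [Set.indicator_of_mem (by simpa using ht), Set.indicator_of_mem (by simpa using ht),
        erlangTail, mul_sum, mul_sum]
      refine sum_congr rfl fun m _ => ?_
      rw [show (m : ℝ) + δ - 1 = (δ - 1) + m by ring, Real.rpow_add ht0, Real.rpow_natCast]
      ring
    · rw [Set.indicator_of_notMem (by simpa using ht), Set.indicator_of_notMem (by simpa using ht),
        mul_zero]
  have hinter : Set.Ici c ∩ Set.Ioi 0 = Set.Ici c :=
    Set.inter_eq_left.2 fun t ht => hc.trans_le ht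
  have hsum : IntegrableOn (fun t : ℝ =>
      ∑ m ∈ range M, t ^ ((m + δ) - 1) * Real.exp (-t) / (m.factorial : ℝ)) (Set.Ioi c) :=
    integrable_finsetSum _ fun m _ => (hint m).div_const _
  rw [heq]
  constructor
  · rw [IntegrableOn, integrable_indicator_iff measurableSet_Ici, IntegrableOn,
      Measure.restrict_restrict measurableSet_Ici, hinter]
    change IntegrableOn _ (Set.Ici c)
    rwa [integrableOn_Ici_iff_integrableOn_Ioi]
  · rw [integral_indicator measurableSet_Ici, Measure.restrict_restrict measurableSet_Ici, hinter,
      integral_Ici_eq_integral_Ioi, integral_finsetSum _ fun m _ => (hint m).div_const _]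
    exact sum_congr rfl fun m _ => integral_div _ _

lemma lintegral_erlangTail_dist (M : ℕ) {μ d₀ ξ : ℝ} (hμ : 0 < μ) (hd₀ : 0 < d₀)
    (hξ : 0 < ξ) (y : Plane) :
    ∫⁻ x : Plane, (Set.Ici d₀).indicator
        (fun r => ENNReal.ofReal (erlangTail M (μ * r ^ ξ))) (dist x y) =
      ENNReal.ofReal (Real.pi * (2 / ξ) / μ ^ (2 / ξ) *
        ∑ m ∈ range M, upperGamma (m + 2 / ξ) (μ * d₀ ^ ξ) / (m.factorial : ℝ)) := by
  set δ := 2 / ξ with hδdef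
  have hδ : 0 < δ := by positivity
  set c := μ * d₀ ^ ξ with hcdef
  have hc : 0 < c := by positivity
  obtain ⟨hHi, hHv⟩ := integrableOn_rpow_mul_erlangTail M hδ hc
  set H : ℝ → ℝ := fun t => t ^ (δ - 1) * (Set.Ici c).indicator (erlangTail M) t with hH
  set F : ℝ → ℝ := (Set.Ici d₀).indicator fun r => erlangTail M (μ * r ^ ξ) with hF
  have hF0 : ∀ r, 0 ≤ F r := by
    intro r
    refine Set.indicator_nonneg (fun r hr => erlangTail_nonneg M ?_) r
    have : 0 ≤ r := hd₀.le.trans hr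
    positivity
  have hofReal : ∀ x : Plane, (Set.Ici d₀).indicator
      (fun r => ENNReal.ofReal (erlangTail M (μ * r ^ ξ))) (dist x y) =
      ENNReal.ofReal (F ‖x - y‖) := by
    intro x
    rw [dist_eq_norm, hF]
    by_cases hx : d₀ ≤ ‖x - y‖ <;> simp [hx]
  -- Substitution t = μ r^ξ: |ξ| r^(ξ-1) is the Jacobian of r ↦ r^ξ. The scaling by μ is carried out
  -- separately and contributes μ⁻¹, so μ^(1-δ) becomes μ^(-δ).
  have hkey : ∀ r ∈ Set.Ioi (0 : ℝ), r ^ (Module.finrank ℝ Plane - 1) • F r =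
      (ξ⁻¹ * μ ^ (1 - δ)) * ((|ξ| * r ^ (ξ - 1)) • H (μ * r ^ ξ)) := by
    intro r hr
    have hr : 0 < r := hr
    have hiff : c ≤ μ * r ^ ξ ↔ d₀ ≤ r := by
      rw [hcdef, mul_le_mul_iff_right₀ hμ, Real.rpow_le_rpow_iff hd₀.le hr.le hξ]
    have hpow : μ ^ (1 - δ) * r ^ (ξ - 1) * (μ * r ^ ξ) ^ (δ - 1) = r := by
      rw [Real.mul_rpow hμ.le (by positivity), ← Real.rpow_mul hr.le]
      calc _ = (μ ^ (1 - δ) * μ ^ (δ - 1)) * (r ^ (ξ - 1) * r ^ (ξ * (δ - 1))) := by ring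
        _ = r := by
          rw [← Real.rpow_add hμ, ← Real.rpow_add hr]
          have h1 : 1 - δ + (δ - 1) = 0 := by ring
          have h2 : ξ - 1 + ξ * (δ - 1) = 1 := by rw [hδdef]; field_simp; ring
          rw [h1, h2, Real.rpow_zero, Real.rpow_one, one_mul]
    have hfin : Module.finrank ℝ Plane - 1 = 1 := by simp
    rw [hfin, pow_one, smul_eq_mul, smul_eq_mul, abs_of_pos hξ, hH, hF]
    by_cases h : d₀ ≤ r
    · rw [Set.indicator_of_mem (by simpa using h)]
      simp only
      rw [Set.indicator_of_mem (by simpa using hiff.2 h)]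
      calc r * erlangTail M (μ * r ^ ξ) =
          (μ ^ (1 - δ) * r ^ (ξ - 1) * (μ * r ^ ξ) ^ (δ - 1)) * erlangTail M (μ * r ^ ξ) := by
            rw [hpow]
        _ = _ := by field_simp
    · rw [Set.indicator_of_notMem (by simpa using h)]
      simp only
      rw [Set.indicator_of_notMem (by simpa using fun h' => h (hiff.1 h'))]
      simp
  have hHμ : IntegrableOn (fun y => H (μ * y)) (Set.Ioi 0) :=
    (integrableOn_Ioi_comp_mul_left_iff H 0 hμ).2 (by rwa [mul_zero])
  have hint : IntegrableOn (fun r : ℝ => r ^ (Module.finrank ℝ Plane - 1) • F r) (Set.Ioi 0) :=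
    IntegrableOn.congr_fun (Integrable.const_mul
      ((integrableOn_Ioi_comp_rpow_iff (fun y => H (μ * y)) hξ.ne').2 hHμ) _)
      (fun r hr => (hkey r hr).symm) measurableSet_Ioi
  have hintF : Integrable (fun x : Plane => F ‖x‖) volume :=
    (integrable_fun_norm_addHaar volume).2 hint
  have hball : (volume : Measure Plane).real (Metric.ball 0 1) = Real.pi := by
    rw [measureReal_def, EuclideanSpace.volume_ball_fin_two]
    simp [Real.pi_nonneg]
  have hval : ∫ x : Plane, F ‖x‖ = Real.pi * δ / μ ^ δ *
      ∑ m ∈ range M, upperGamma (m + δ) c / (m.factorial : ℝ) := by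
    rw [integral_fun_norm_addHaar, hball, setIntegral_congr_fun measurableSet_Ioi hkey,
      integral_const_mul, integral_comp_rpow_Ioi (fun y => H (μ * y)) hξ.ne',
      integral_comp_mul_left_Ioi H 0 hμ, mul_zero, hHv, Real.rpow_sub hμ, Real.rpow_one]
    have : (Module.finrank ℝ Plane) = 2 := by simp
    rw [this, hδdef]
    simp only [nsmul_eq_mul, smul_eq_mul]
    field_simp
    norm_num
  simp_rw [hofReal]
  rw [lintegral_sub_right_eq_self (fun x : Plane => ENNReal.ofReal (F ‖x‖)) y,
    ← ofReal_integral_eq_lintegral_ofReal hintF (ae_of_all _ fun x => hF0 _), hval]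

end RadialIntegral

/-! ### Strongest gain and outage probabilities -/

section Outage

variable {Ω : Type*} [MeasurableSpace Ω] {P : Measure Ω} [IsProbabilityMeasure P] {p : Params}
  {X : ℕ → Ω → Plane} {h : ℕ → Ω → EuclideanSpace ℂ (Fin p.M)}

namespace Params

/-- Positions and squared channel norms of the beacons outside the protection zone of a user at `y`
whose gain lies in `S`. -/
def gainRegion (p : Params) (y : Plane) (S : Set ℝ) : Set (Plane × ℝ) :=
  {z | p.d₀ ≤ dist z.1 y ∧ z.2 * p.pathLoss (dist z.1 y) ∈ S}

lemma measurableSet_gainRegion (y : Plane) {S : Set ℝ} (hS : MeasurableSet S) :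
    MeasurableSet (p.gainRegion y S) := by
  have hm : Measurable fun z : Plane × ℝ => z.2 * p.pathLoss (dist z.1 y) := by
    unfold pathLoss
    exact measurable_snd.mul (((measurable_fst.dist measurable_const).pow_const _).const_mul _)
  exact (measurableSet_le measurable_const (measurable_fst.dist measurable_const)).inter (hm hS)

lemma pathLoss_pos (hp : p.Admissible) {d : ℝ} (hd : p.d₀ ≤ d) : 0 < p.pathLoss d :=
  mul_pos hp.A_pos (Real.rpow_pos_of_pos (hp.d₀_pos.trans_le hd) _)

lemma forall_gains_iff {Ω : Type*} {X : ℕ → Ω → Plane} {h : ℕ → Ω → EuclideanSpace ℂ (Fin p.M)}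
    {S : Set ℝ} (y : Plane) (ω : Ω) :
    (∀ n, (X n ω, ‖h n ω‖ ^ 2) ∉ p.gainRegion y S) ↔ ∀ g ∈ p.gains X h y ω, g ∉ S := by
  constructor
  · rintro H g ⟨n, hn, rfl⟩ hg
    exact H n ⟨hn, hg⟩
  · rintro H n ⟨hn, hg⟩
    exact H _ ⟨n, hn, rfl⟩ hg

/-- Turns the level Aμ for the gain into the level μ d^ξ for ‖h‖². -/
lemma mul_mul_pathLoss (hp : p.Admissible) (μ : ℝ) {d : ℝ} (hd : p.d₀ ≤ d) :
    p.A * μ = μ * d ^ p.ξ * p.pathLoss d := by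
  have hd0 : 0 < d := hp.d₀_pos.trans_le hd
  rw [pathLoss, Real.rpow_neg hd0.le]
  have : d ^ p.ξ ≠ 0 := (Real.rpow_pos_of_pos hd0 _).ne'
  field_simp

lemma preimage_gainRegion_Ioi (hp : p.Admissible) (y x : Plane) (μ : ℝ) (hx : p.d₀ ≤ dist x y) :
    Prod.mk x ⁻¹' p.gainRegion y (Set.Ioi (p.A * μ)) = Set.Ioi (μ * dist x y ^ p.ξ) := by
  ext s
  simp only [gainRegion, Set.mem_preimage, Set.mem_ofPred_eq, hx, true_and, Set.mem_Ioi]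
  rw [mul_mul_pathLoss hp μ hx, mul_lt_mul_iff_left₀ (pathLoss_pos hp hx)]

lemma preimage_gainRegion_Ici (hp : p.Admissible) (y x : Plane) (μ : ℝ) (hx : p.d₀ ≤ dist x y) :
    Prod.mk x ⁻¹' p.gainRegion y (Set.Ici (p.A * μ)) = Set.Ici (μ * dist x y ^ p.ξ) := by
  ext s
  simp only [gainRegion, Set.mem_preimage, Set.mem_ofPred_eq, hx, true_and, Set.mem_Ici]
  rw [mul_mul_pathLoss hp μ hx, mul_le_mul_iff_left₀ (pathLoss_pos hp hx)]

lemma preimage_gainRegion_of_lt (y x : Plane) (S : Set ℝ) (hx : dist x y < p.d₀) :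
    Prod.mk x ⁻¹' p.gainRegion y S = ∅ := by
  ext s
  simp [gainRegion, hx]

/-- Open and closed half-lines give the same value because the Erlang law has no atom at μ r^ξ > 0.
-/
lemma erlang_gainRegion (hp : p.Admissible) (y x : Plane) {μ : ℝ} (hμ : 0 < μ) {S : Set ℝ}
    (hS : S = Set.Ioi (p.A * μ) ∨ S = Set.Ici (p.A * μ)) :
    erlang p.M (Prod.mk x ⁻¹' p.gainRegion y S) = (Set.Ici p.d₀).indicator
      (fun r => ENNReal.ofReal (erlangTail p.M (μ * r ^ p.ξ))) (dist x y) := by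
  by_cases hx : p.d₀ ≤ dist x y
  · have hd : 0 < dist x y := hp.d₀_pos.trans_le hx
    rw [Set.indicator_of_mem (by simpa using hx)]
    rcases hS with rfl | rfl
    · rw [preimage_gainRegion_Ioi hp y x μ hx, erlang_Ioi _ (by positivity)]
    · rw [preimage_gainRegion_Ici hp y x μ hx, erlang_Ici _ (by positivity)]
  · rw [Set.indicator_of_notMem (by simpa using hx),
      preimage_gainRegion_of_lt y x S (not_le.1 hx), measure_empty]

/-- The mean number of beacons outside the protection zone whose gain exceeds `A μ`. -/
lemma lintegral_erlang_gainRegion (hp : p.Admissible) (y : Plane) {μ : ℝ} (hμ : 0 < μ) {S : Set ℝ}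
    (hS : S = Set.Ioi (p.A * μ) ∨ S = Set.Ici (p.A * μ)) :
    ∫⁻ x, erlang p.M (Prod.mk x ⁻¹' p.gainRegion y S)
        ∂(ENNReal.ofReal p.lam • (volume : Measure Plane)) =
      ENNReal.ofReal (Real.pi * p.lam * p.δ / μ ^ p.δ *
        ∑ m ∈ range p.M, upperGamma (m + p.δ) (μ * p.d₀ ^ p.ξ) / (m.factorial : ℝ)) := by
  simp_rw [fun x => erlang_gainRegion hp y x hμ hS]
  rw [lintegral_smul_measure, lintegral_erlangTail_dist p.M hμ hp.d₀_pos
    (two_pos.trans_le hp.two_le_ξ), smul_eq_mul, ← ENNReal.ofReal_mul hp.lam_pos.le]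
  congr 1
  simp only [δ]
  ring

lemma upperGamma_nonneg (s : ℝ) {x : ℝ} (hx : 0 ≤ x) : 0 ≤ upperGamma s x :=
  setIntegral_nonneg measurableSet_Ioi fun _ ht =>
    mul_nonneg (Real.rpow_nonneg (hx.trans (le_of_lt ht)) _) (Real.exp_nonneg _)

instance (r : ℝ) : SigmaFinite (ENNReal.ofReal r • (volume : Measure Plane)) :=
  inferInstanceAs (SigmaFinite (r.toNNReal • (volume : Measure Plane)))

/-- The probability that no gain exceeds (or reaches) `A μ`. -/
lemma measureReal_forall_gains_notMem (hp : p.Admissible) (hX : IsBeaconField p.lam X h P)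
    (y : Plane) {μ : ℝ} (hμ : 0 < μ) {S : Set ℝ}
    (hS : S = Set.Ioi (p.A * μ) ∨ S = Set.Ici (p.A * μ)) :
    P.real {ω | ∀ g ∈ p.gains X h y ω, g ∉ S} = p.outageFormula μ := by
  have hSm : MeasurableSet S := by
    rcases hS with rfl | rfl
    exacts [measurableSet_Ioi, measurableSet_Ici]
  have hnn : 0 ≤ Real.pi * p.lam * p.δ / μ ^ p.δ *
      ∑ m ∈ range p.M, upperGamma (m + p.δ) (μ * p.d₀ ^ p.ξ) / (m.factorial : ℝ) := by
    have h1 : 0 ≤ p.δ := div_nonneg two_pos.le (two_pos.le.trans hp.two_le_ξ)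
    have h2 : 0 ≤ p.lam := hp.lam_pos.le
    have h3 : 0 ≤ p.d₀ := hp.d₀_pos.le
    refine mul_nonneg (by positivity) (sum_nonneg fun m _ => div_nonneg ?_ (by positivity))
    exact upperGamma_nonneg _ (by positivity)
  simp_rw [← forall_gains_iff (p := p) (X := X) (h := h) (S := S) y]
  rw [measureReal_def, hX.ppp.measure_forall_notMem hX.isIndepMarking
    (measurableSet_gainRegion y hSm), lintegral_erlang_gainRegion hp y hμ hS,
    EReal.coe_ennreal_ofReal, max_eq_left hnn, ← EReal.coe_neg, EReal.exp_coe,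
    ENNReal.toReal_ofReal (Real.exp_nonneg _), outageFormula]

lemma ae_finite_gains_gt (hp : p.Admissible) (hX : IsBeaconField p.lam X h P) (y : Plane)
    {μ : ℝ} (hμ : 0 < μ) :
    ∀ᵐ ω ∂P, {n | (X n ω, ‖h n ω‖ ^ 2) ∈ p.gainRegion y (Set.Ioi (p.A * μ))}.Finite := by
  refine hX.ppp.ae_finite_marked hX.isIndepMarking
    (measurableSet_gainRegion y measurableSet_Ioi) ?_
  rw [lintegral_erlang_gainRegion hp y hμ (Or.inl rfl)]
  exact ENNReal.ofReal_ne_top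

/-- As M ≥ 1, each mark is almost surely positive, so every beacon outside the protection disc
counts. The complement of the disc has infinite area, hence the void probability is exp(-∞) = 0. -/
lemma ae_exists_pos_gain (hp : p.Admissible) (hX : IsBeaconField p.lam X h P) (y : Plane) :
    ∀ᵐ ω ∂P, ∃ g ∈ p.gains X h y ω, 0 < g := by
  have hsec : ∀ x, erlang p.M (Prod.mk x ⁻¹' p.gainRegion y (Set.Ioi 0)) =
      (Metric.ball y p.d₀)ᶜ.indicator 1 x := by
    intro x
    by_cases hx : p.d₀ ≤ dist x y
    · have h1 := preimage_gainRegion_Ioi hp y x 0 hx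
      rw [mul_zero, zero_mul] at h1
      have h2 : erlangTail p.M 0 = 1 := by
        obtain ⟨M, hM⟩ := Nat.exists_eq_succ_of_ne_zero hp.M_pos.ne'
        simp [erlangTail, hM, sum_range_succ']
      rw [h1, erlang_Ioi _ le_rfl, h2, Set.indicator_of_mem (by simpa using hx)]
      simp
    · rw [preimage_gainRegion_of_lt y x _ (not_le.1 hx), measure_empty,
        Set.indicator_of_notMem (by simpa using hx)]
  have htop : (volume : Measure Plane) (Metric.ball y p.d₀)ᶜ = ⊤ := by
    rw [measure_compl Metric.isOpen_ball.measurableSet measure_ball_lt_top.ne,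
      measure_univ_of_isAddLeftInvariant, ENNReal.top_sub measure_ball_lt_top.ne]
  have hzero : P {ω | ∀ n, (X n ω, ‖h n ω‖ ^ 2) ∉ p.gainRegion y (Set.Ioi 0)} = 0 := by
    rw [hX.ppp.measure_forall_notMem hX.isIndepMarking
      (measurableSet_gainRegion y measurableSet_Ioi)]
    simp_rw [hsec]
    rw [lintegral_indicator_one Metric.isOpen_ball.measurableSet.compl, Measure.smul_apply, htop,
      smul_eq_mul, ENNReal.mul_top (by simpa using hp.lam_pos)]
    simp
  rw [ae_iff]
  refine measure_mono_null (fun ω hω => ?_) hzero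
  rw [Set.mem_ofPred_eq, forall_gains_iff]
  intro g hg hpos
  exact hω ⟨g, hg, hpos⟩

/-- Almost surely the strongest channel gain is attained. -/
theorem ae_isGreatest_maxGain (hp : p.Admissible) (hX : IsBeaconField p.lam X h P) (y : Plane) :
    ∀ᵐ ω ∂P, IsGreatest (p.gains X h y ω) (p.maxGain X h y ω) := by
  -- Countably many levels, so that one null set serves for all of them.
  have hfin : ∀ᵐ ω ∂P, ∀ k : ℕ, {n | (X n ω, ‖h n ω‖ ^ 2) ∈
      p.gainRegion y (Set.Ioi (p.A * (1 / (k + 1 : ℝ))))}.Finite :=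
    ae_all_iff.2 fun k => ae_finite_gains_gt hp hX y (by positivity)
  filter_upwards [hfin, ae_exists_pos_gain hp hX y] with ω hω ⟨g₀, hg₀, hpos⟩
  -- A level t strictly below an existing gain: the gains above t form a finite nonempty set, whose
  -- largest element dominates all the others too.
  obtain ⟨k, hk⟩ := exists_nat_one_div_lt (div_pos hpos hp.A_pos)
  have hk' : p.A * (1 / (k + 1 : ℝ)) < g₀ := by
    rwa [lt_div_iff₀ hp.A_pos, mul_comm] at hk
  set t := p.A * (1 / (k + 1 : ℝ)) with ht
  have hbig : (p.gains X h y ω ∩ Set.Ioi t).Finite := by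
    refine ((hω k).image fun n => ‖h n ω‖ ^ 2 * p.pathLoss (dist (X n ω) y)).subset ?_
    rintro g ⟨⟨n, hn, rfl⟩, hg⟩
    exact ⟨n, ⟨hn, hg⟩, rfl⟩
  obtain ⟨g, hg, hmax⟩ := Set.exists_max_image _ id hbig ⟨g₀, hg₀, hk'⟩
  have hgreat : IsGreatest (p.gains X h y ω) g := by
    refine ⟨hg.1, fun g' hg' => ?_⟩
    by_cases h' : t < g'
    · exact hmax g' ⟨hg', h'⟩
    · exact (not_lt.1 h').trans (le_of_lt hg.2)
  rwa [maxGain, hgreat.csSup_eq]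

lemma measureReal_maxGain_le (hp : p.Admissible) (hX : IsBeaconField p.lam X h P) (y : Plane)
    {μ : ℝ} (hμ : 0 < μ) : P.real {ω | p.maxGain X h y ω ≤ p.A * μ} = p.outageFormula μ := by
  rw [← measureReal_forall_gains_notMem hp hX y hμ (Or.inl rfl)]
  refine measureReal_congr ?_
  filter_upwards [ae_isGreatest_maxGain hp hX y] with ω hω
  refine propext ⟨fun H g hg => not_lt.2 ((hω.2 hg).trans H), fun H => not_lt.1 (H _ hω.1)⟩

/-- Attainment is essential here: if every gain is below Aμ, a supremum that is not attained could
still equal Aμ. -/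
lemma measureReal_maxGain_lt (hp : p.Admissible) (hX : IsBeaconField p.lam X h P) (y : Plane)
    {μ : ℝ} (hμ : 0 < μ) : P.real {ω | p.maxGain X h y ω < p.A * μ} = p.outageFormula μ := by
  rw [← measureReal_forall_gains_notMem hp hX y hμ (Or.inr rfl)]
  refine measureReal_congr ?_
  filter_upwards [ae_isGreatest_maxGain hp hX y] with ω hω
  refine propext ⟨fun H g hg => not_le.2 ((hω.2 hg).trans_lt H), fun H => not_le.1 (H _ hω.1)⟩

/-- Both harvesting slots see the same maximum, so their energies add up to that of the fraction α₁
+ α₂; the frame length T then cancels. -/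
lemma activePower_le_iff {Ω : Type*} {X : ℕ → Ω → Plane}
    {h : ℕ → Ω → EuclideanSpace ℂ (Fin p.M)} (hp : p.Admissible) (y : Plane) (ω : Ω) :
    p.activePower X h y ω ≤ p.Pt ↔ p.maxGain X h y ω ≤ p.A * p.muActive := by
  obtain ⟨-, -, -, -, hA, hη, hPp, -, -, hT, -, -, -, ha, ht⟩ := hp
  have hr : 0 < 1 - p.α₁ - p.β - p.α₂ := by linarith
  have hmu : p.A * p.muActive = (p.Pt * (1 - p.α₁ - p.β - p.α₂) + p.Ps * p.β) /
      (p.η * p.Pp * (p.α₁ + p.α₂)) := by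
    rw [muActive]; field_simp
  rw [hmu, le_div_iff₀ (by positivity), activePower, div_le_iff₀ (by positivity), harvestedEnergy,
    harvestedEnergy, sensingEnergy, ← mul_le_mul_iff_left₀ hT (b := p.maxGain X h y ω * _)]
  constructor <;> intro H <;> linarith

lemma inactivePower_lt_iff {Ω : Type*} {X : ℕ → Ω → Plane}
    {h : ℕ → Ω → EuclideanSpace ℂ (Fin p.M)} (hp : p.Admissible) (y : Plane) (ω : Ω) :
    p.inactivePower X h y ω < p.Pt ↔ p.maxGain X h y ω < p.A * p.muInactive := by
  obtain ⟨-, -, -, -, hA, hη, hPp, -, -, hT, -, hβ, -, ha, ht⟩ := hp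
  have hr : 0 < 1 - p.α₁ - p.β - p.α₂ := by linarith
  have ha' : 0 < p.α₁ + p.β + p.α₂ := by linarith
  have hmu : p.A * p.muInactive = p.Pt * (1 - p.α₁ - p.β - p.α₂) /
      (p.η * p.Pp * (p.α₁ + p.β + p.α₂)) := by
    rw [muInactive]; field_simp
  rw [hmu, lt_div_iff₀ (by positivity), inactivePower, div_lt_iff₀ (by positivity),
    harvestedEnergy, ← mul_lt_mul_iff_left₀ hT (b := p.maxGain X h y ω * _)]
  constructor <;> intro H <;> linarith

lemma muActive_pos (hp : p.Admissible) : 0 < p.muActive := by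
  obtain ⟨-, -, -, -, hA, hη, hPp, hPs, hPt, hT, -, hβ, -, ha, ht⟩ := hp
  have hr : 0 < 1 - p.α₁ - p.β - p.α₂ := by linarith
  unfold muActive; positivity

lemma muInactive_pos (hp : p.Admissible) : 0 < p.muInactive := by
  obtain ⟨-, -, -, -, hA, hη, hPp, hPs, hPt, hT, -, hβ, -, ha, ht⟩ := hp
  have hr : 0 < 1 - p.α₁ - p.β - p.α₂ := by linarith
  have ha' : 0 < p.α₁ + p.β + p.α₂ := by linarith
  unfold muInactive; positivity

end Params

end Outage

end WPCR

theorem theorem2 {Ω : Type*} [MeasurableSpace Ω] (P : Measure Ω) [IsProbabilityMeasure P]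
    (p : WPCR.Params) (hp : p.Admissible)
    (X : ℕ → Ω → WPCR.Plane) (h : ℕ → Ω → EuclideanSpace ℂ (Fin p.M))
    (hX : WPCR.IsBeaconField p.lam X h P) (y : WPCR.Plane) :
    (∀ᵐ ω ∂P, IsGreatest (p.gains X h y ω) (p.maxGain X h y ω)) ∧
    P.real {ω | p.activePower X h y ω ≤ p.Pt} = p.outageFormula p.muActive ∧
    P.real {ω | p.inactivePower X h y ω < p.Pt} = p.outageFormula p.muInactive := by
  refine ⟨WPCR.Params.ae_isGreatest_maxGain hp hX y, ?_, ?_⟩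
  · simp_rw [WPCR.Params.activePower_le_iff hp]
    exact WPCR.Params.measureReal_maxGain_le hp hX y (WPCR.Params.muActive_pos hp)
  · simp_rw [WPCR.Params.inactivePower_lt_iff hp]
    exact WPCR.Params.measureReal_maxGain_lt hp hX y (WPCR.Params.muInactive_pos hp)
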